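/- An $n$-qubit state is a unit vector in $\mathbb{C}^{2^n}$, with orthonormal basis $\{|x\rangle : x\in\mathbb{F}_2^n\}$. The Pauli group is $\mathcal{P}_n=\{i^cX^aZ^b : c\in\mathbb{Z}_4,\ a,b\in\mathbb{F}_2^n\}$, where $X^a|x\rangle=|x+a\rangle$ and $Z^b|x\rangle=(-1)^{\langle b,x\rangle}|x\rangle$. An $n$-qubit state $|s\rangle$ is a stabilizer state if there is an abelian subgroup $S\subseteq\mathcal{P}_n$ of order $2^n$ with $p|s\rangle=|s\rangle$ for all $p\in S$; let $\mathrm{Stab}_n$ be the set of $n$-qubit stabilizer states. For an $n$-qubit state $|\phi\rangle$, the (exact) stabilizer rank $\chi(\phi)$ is the least $r$ such that $|\phi\rangle\in\mathrm{span}(|s_1\rangle,\dots,|s_r\rangle)$ for some $|s_1\rangle,\dots,|s_r\rangle\in\mathrm{Stab}_n$, and the stabilizer fidelity is $F(\phi)=\max_{|s\rangle\in\mathrm{Stab}_n}|\langle s|\phi\rangle|^2$. **Theorem (Relating stabilizer rank and fidelity).** For every integer $k>0$ there exists $\delta_k>0$, depending only on $k$ (in particular not on the number of qubits), such that for every $n$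 and every $n$-qubit state $|\phi\rangle$ with $\chi(\phi)\le k$ one has $F(\phi)\ge\delta_k$. -/

import Mathlib

open scoped Matrix

noncomputable section

/-- Computational basis labels of `n` qubits: the vector space `𝔽₂ⁿ`. -/
abbrev Bits (n : ℕ) : Type := Fin n → ZMod 2

/-- The Hilbert space of `n` qubits, `ℂ^(2^n)` with orthonormal basis indexed by `𝔽₂ⁿ`. -/
abbrev QubitSpace (n : ℕ) : Type := EuclideanSpace ℂ (Bits n)

/-- The sign `(-1)^t` of `t ∈ 𝔽₂`. -/
def signOf (t : ZMod 2) : ℂ := (-1) ^ t.val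

/-- The operator `X^a`, mapping `|x⟩` to `|x + a⟩`. -/
def pauliX {n : ℕ} (a : Bits n) : Matrix (Bits n) (Bits n) ℂ :=
  Matrix.of fun y x => if y = x + a then 1 else 0

/-- The operator `Z^b`, mapping `|x⟩` to `(-1)^⟨b, x⟩ |x⟩`. -/
def pauliZ {n : ℕ} (b : Bits n) : Matrix (Bits n) (Bits n) ℂ :=
  Matrix.diagonal fun x => signOf (b ⬝ᵥ x)

/-- The Pauli operator `i^c X^a Z^b`. -/
def pauliOp {n : ℕ} (c : ZMod 4) (a b : Bits n) : Matrix (Bits n) (Bits n) ℂ :=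
  Complex.I ^ c.val • (pauliX a * pauliZ b)

theorem signOf_add (s t : ZMod 2) : signOf (s + t) = signOf s * signOf t := by
  unfold signOf
  have key : ∀ s t : ZMod 2, (s + t).val % 2 = (s.val + t.val) % 2 := by decide
  rw [← pow_add, neg_one_pow_eq_pow_mod_two, key, ← neg_one_pow_eq_pow_mod_two]

theorem I_pow_zmod (m : ℕ) : Complex.I ^ ((m : ZMod 4)).val = Complex.I ^ m := by
  rw [ZMod.val_natCast, ← Complex.I_pow_eq_pow_mod]

theorem signOf_eq_I_pow (t : ZMod 2) : signOf t = Complex.I ^ (2 * t.val) := by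
  rw [signOf, pow_mul, Complex.I_sq]

theorem pauliOp_apply {n : ℕ} (c : ZMod 4) (a b y x : Bits n) :
    pauliOp c a b y x = if y = x + a then Complex.I ^ c.val * signOf (b ⬝ᵥ x) else 0 := by
  simp [pauliOp, pauliX, pauliZ, Matrix.mul_diagonal]

theorem pauliOp_one {n : ℕ} : pauliOp (n := n) 0 0 0 = 1 := by
  ext y x
  simp [pauliOp_apply, Matrix.one_apply, signOf]

theorem pauliOp_mul {n : ℕ} (c c' : ZMod 4) (a b a' b' : Bits n) :
    pauliOp c a b * pauliOp c' a' b' =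
      pauliOp ((c.val + c'.val + 2 * (b ⬝ᵥ a').val : ℕ) : ZMod 4) (a + a') (b + b') := by
  ext y x
  rw [Matrix.mul_apply, pauliOp_apply, I_pow_zmod, pow_add, pow_add, ← signOf_eq_I_pow]
  rw [Finset.sum_eq_single (x + a')]
  · simp only [pauliOp_apply, if_true, dotProduct_add, add_dotProduct, signOf_add]
    by_cases h : y = x + a' + a
    · rw [if_pos h, if_pos (by rw [h]; abel)]; ring
    · rw [if_neg h, if_neg (by intro h'; apply h; rw [h']; abel)]; ring
  · intro z _ hz
    simp [pauliOp_apply, hz]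
  · simp

theorem bits_add_self {n : ℕ} (a : Bits n) : a + a = 0 := by
  funext i
  exact CharTwo.add_self_eq_zero (a i)

/-- Every Pauli operator has a Pauli operator as a right inverse. -/
theorem pauliOp_right_inv {n : ℕ} (c : ZMod 4) (a b : Bits n) :
    ∃ c' : ZMod 4, pauliOp c a b * pauliOp c' a b = 1 := by
  refine ⟨-c - ((2 * (b ⬝ᵥ a).val : ℕ) : ZMod 4), ?_⟩
  rw [pauliOp_mul, bits_add_self, bits_add_self, ← pauliOp_one]
  congr 1
  push_cast
  simp only [ZMod.natCast_val, ZMod.cast_id', id]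
  ring

/-- The Pauli group `{i^c X^a Z^b : (a, b) ∈ 𝔽₂ⁿ × 𝔽₂ⁿ, c ∈ ℤ/4}` on `n` qubits. -/
def pauliGroup (n : ℕ) : Subgroup (Matrix.unitaryGroup (Bits n) ℂ) where
  carrier := {U | ∃ (c : ZMod 4) (a b : Bits n), (U : Matrix (Bits n) (Bits n) ℂ) = pauliOp c a b}
  one_mem' := ⟨0, 0, 0, by rw [pauliOp_one]; rfl⟩
  mul_mem' := by
    rintro U V ⟨c, a, b, hU⟩ ⟨c', a', b', hV⟩
    exact ⟨_, _, _, by rw [Submonoid.coe_mul, hU, hV, pauliOp_mul]⟩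
  inv_mem' := by
    rintro U ⟨c, a, b, hU⟩
    obtain ⟨c', h⟩ := pauliOp_right_inv c a b
    refine ⟨c', a, b, ?_⟩
    have h1 : ((U⁻¹ : Matrix.unitaryGroup (Bits n) ℂ) : Matrix (Bits n) (Bits n) ℂ)
        * pauliOp c a b = 1 := by
      rw [← hU, ← Submonoid.coe_mul, inv_mul_cancel]; rfl
    exact left_inv_eq_right_inv h1 h

/-- `Stab_n`: the unit vectors fixed by every element of some abelian subgroup of order `2^n`
of the Pauli group. -/
def stabilizerStates (n : ℕ) : Set (QubitSpace n) :=
  {s | ‖s‖ = 1 ∧ ∃ S : Subgroup (Matrix.unitaryGroup (Bits n) ℂ),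
    S ≤ pauliGroup n ∧ IsMulCommutative S ∧ Nat.card S = 2 ^ n ∧
    ∀ p ∈ S, (p : Matrix (Bits n) (Bits n) ℂ) *ᵥ s.ofLp = s.ofLp}

/-- The exact stabilizer rank `χ(φ)`: the least `r` such that `φ` lies in the span of `r`
stabilizer states. -/
def stabilizerRank {n : ℕ} (φ : QubitSpace n) : ℕ∞ :=
  sInf {r : ℕ∞ | ∃ m : ℕ, r = m ∧ ∃ s : Fin m → QubitSpace n,
    (∀ i, s i ∈ stabilizerStates n) ∧ φ ∈ Submodule.span ℂ (Set.range s)}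

/-- The stabilizer fidelity `F(φ)`: the maximum of `|⟨s|φ⟩|²` over stabilizer states `s`
(the supremum is a maximum by `isGreatest_stabilizerFidelity`). -/
def stabilizerFidelity {n : ℕ} (φ : QubitSpace n) : ℝ :=
  sSup ((fun s : QubitSpace n => ‖inner ℂ s φ‖ ^ 2) '' stabilizerStates n)

theorem pauliZ_eq {n : ℕ} (b : Bits n) : pauliZ b = pauliOp 0 0 b := by
  ext y x
  rw [pauliOp_apply, pauliZ, Matrix.diagonal_apply]
  by_cases h : y = x <;> simp [h]

theorem pauliZ_add {n : ℕ} (b b' : Bits n) : pauliZ (b + b') = pauliZ b * pauliZ b' := by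
  simp [pauliZ, Matrix.diagonal_mul_diagonal, add_dotProduct, signOf_add]

theorem pauliZ_zero {n : ℕ} : pauliZ (0 : Bits n) = 1 := by
  simp [pauliZ, signOf]

theorem pauliZ_mem_unitaryGroup {n : ℕ} (b : Bits n) :
    pauliZ b ∈ Matrix.unitaryGroup (Bits n) ℂ := by
  have h : star (pauliZ b) = pauliZ b := by
    rw [Matrix.star_eq_conjTranspose, pauliZ, Matrix.diagonal_conjTranspose]
    congr 1
    funext x
    simp [signOf]
  rw [Matrix.mem_unitaryGroup_iff, h, ← pauliZ_add, bits_add_self, pauliZ_zero]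

/-- The operators `Z^b`, as a homomorphism into the unitary group. -/
def pauliZHom (n : ℕ) : Multiplicative (Bits n) →* Matrix.unitaryGroup (Bits n) ℂ where
  toFun b := ⟨pauliZ b.toAdd, pauliZ_mem_unitaryGroup _⟩
  map_one' := Subtype.ext pauliZ_zero
  map_mul' b b' := Subtype.ext (pauliZ_add b.toAdd b'.toAdd)

theorem pauliZHom_injective (n : ℕ) : Function.Injective (pauliZHom n) := by
  rw [injective_iff_map_eq_one]
  intro b hb
  have hZ : pauliZ b.toAdd = 1 := congrArg Subtype.val hb
  apply Multiplicative.toAdd.injective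
  funext i
  have h := congrFun (congrFun hZ (Pi.single i 1)) (Pi.single i 1)
  simp only [pauliZ, Matrix.diagonal_apply_eq, dotProduct_single, mul_one,
    Matrix.one_apply_eq] at h
  change b.toAdd i = 0
  generalize b.toAdd i = t at h
  fin_cases t
  · rfl
  · exfalso
    have h2 : signOf 1 = -1 := by
      have : (1 : ZMod 2).val = 1 := by decide
      rw [signOf, this, pow_one]
    change signOf 1 = 1 at h
    rw [h2] at h
    norm_num at h

/-- The state `|0…0⟩` is a stabilizer state. -/
theorem zeroState_mem_stabilizerStates (n : ℕ) :
    EuclideanSpace.single (0 : Bits n) (1 : ℂ) ∈ stabilizerStates n := by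
  refine ⟨by simp, (pauliZHom n).range, ?_, inferInstance, ?_, ?_⟩
  · rintro _ ⟨b, rfl⟩
    exact ⟨0, 0, b.toAdd, pauliZ_eq _⟩
  · rw [← Nat.card_congr (MonoidHom.ofInjective (pauliZHom_injective n)).toEquiv]
    simp [Nat.card_eq_fintype_card]
  · rintro _ ⟨b, rfl⟩
    change pauliZ b.toAdd *ᵥ _ = _
    funext x
    rw [pauliZ, Matrix.mulVec_diagonal]
    by_cases h : x = 0
    · subst h; simp [signOf]
    · simp [h]

theorem isCompact_stabilizerStates (n : ℕ) : IsCompact (stabilizerStates n) := by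
  have hP : ((pauliGroup n : Subgroup _) : Set (Matrix.unitaryGroup (Bits n) ℂ)).Finite := by
    have hfin : (Set.range fun q : ZMod 4 × Bits n × Bits n =>
        pauliOp q.1 q.2.1 q.2.2).Finite := Set.finite_range _
    refine (hfin.preimage (f := fun U : Matrix.unitaryGroup (Bits n) ℂ =>
      (U : Matrix (Bits n) (Bits n) ℂ)) Subtype.val_injective.injOn).subset ?_
    rintro U ⟨c, a, b, h⟩
    exact ⟨(c, a, b), h.symm⟩
  have hS : {S : Subgroup (Matrix.unitaryGroup (Bits n) ℂ) | S ≤ pauliGroup n ∧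
      IsMulCommutative S ∧ Nat.card S = 2 ^ n}.Finite :=
    (hP.finite_subsets.preimage (f := fun S : Subgroup (Matrix.unitaryGroup (Bits n) ℂ) =>
      (S : Set (Matrix.unitaryGroup (Bits n) ℂ))) SetLike.coe_injective.injOn).subset
      fun S h => h.1
  have hunion : stabilizerStates n = Metric.sphere 0 1 ∩
      ⋃ S ∈ {S : Subgroup (Matrix.unitaryGroup (Bits n) ℂ) | S ≤ pauliGroup n ∧
        IsMulCommutative S ∧ Nat.card S = 2 ^ n},
        ⋂ p ∈ S, {s : QubitSpace n |
          (p : Matrix (Bits n) (Bits n) ℂ) *ᵥ s.ofLp = s.ofLp} := by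
    ext s
    simp [stabilizerStates, and_assoc]
  rw [hunion]
  refine (isCompact_sphere _ _).inter_right (hS.isClosed_biUnion fun S _ => ?_)
  refine isClosed_biInter fun p _ => isClosed_eq ?_ (PiLp.continuous_ofLp 2 _)
  exact continuous_const.matrix_mulVec (PiLp.continuous_ofLp 2 _)

/-- The supremum defining the stabilizer fidelity is attained. -/
theorem isGreatest_stabilizerFidelity {n : ℕ} (φ : QubitSpace n) :
    IsGreatest ((fun s : QubitSpace n => ‖inner ℂ s φ‖ ^ 2) '' stabilizerStates n)
      (stabilizerFidelity φ) := by
  refine IsCompact.isGreatest_sSup ((isCompact_stabilizerStates n).image (by fun_prop)) ?_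
  exact ⟨_, _, zeroState_mem_stabilizerStates n, rfl⟩

end

open scoped Matrix

/-! If `φ = ∑ e i • t i` with `t i` stabilizer states, then `1 = |⟨φ, φ⟩| ≤ ∑ |e i| |⟨φ, t i⟩| ≤ (∑
|e i|) √F`, so a bound on the coefficients that does not involve the number of qubits suffices
(`exists_stabilizer_coefficient_bound`). Discarding dependent states, one must show that `r`
independent stabilizer states are uniformly well conditioned.

Closeness of two states is measured by `μ(s, t) = |P_s ∩ P_t| / 2^n`, where `P_s` is the group of
Paulis having `s` as an eigenvector. Three facts carry the argument: `|⟨s, t⟩|² ≤ μ(s, t)`; `μ(s, t)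
μ(t, u) ≤ 4 μ(s, u)`; and a nonzero multiple of `t` is a sum of at most `4 / μ(s, t)` Pauli images
of `s`. Since `⟨s, U s⟩` is `0` or a power of `i` for every Pauli `U`, states rescaled relative to a
common `s` have Gaussian integer inner products.

By pigeonhole on a rapidly decreasing sequence of thresholds, some gap between consecutive
thresholds contains no `μ`, and closeness at that scale is an equivalence relation. Within a class,
the rescaled Gram matrix has bounded Gaussian integer entries, so only finitely many matrices occur
and their least eigenvalues have a common positive lower bound. Across classes, inner products are
too small to spoil it (`exists_coefficient_bound`). -/

/-! ### Traces, unitarity and commutation of Pauli operators -/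

theorem signOf_one : signOf 1 = -1 := by
  have : (1 : ZMod 2).val = 1 := by decide
  rw [signOf, this, pow_one]

theorem sum_signOf_dotProduct {n : ℕ} (b : Bits n) :
    ∑ x : Bits n, signOf (b ⬝ᵥ x) = if b = 0 then (2 : ℂ) ^ n else 0 := by
  split_ifs with h
  · subst h
    simp [signOf]
  · obtain ⟨i, hi⟩ := Function.ne_iff.mp h
    have hbi : b i = 1 := by
      have key : ∀ t : ZMod 2, t ≠ 0 → t = 1 := by decide
      exact key _ hi
    have h1 := Equiv.sum_comp (Equiv.addRight (Pi.single i (1 : ZMod 2)))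
      (fun x : Bits n => signOf (b ⬝ᵥ x))
    simp only [Equiv.coe_addRight, dotProduct_add, dotProduct_single, mul_one, signOf_add, hbi,
      signOf_one, mul_neg, Finset.sum_neg_distrib] at h1
    exact self_eq_neg.mp h1.symm

theorem trace_pauliOp {n : ℕ} (c : ZMod 4) (a b : Bits n) :
    (pauliOp c a b).trace = if a = 0 ∧ b = 0 then Complex.I ^ c.val * 2 ^ n else 0 := by
  simp only [Matrix.trace, Matrix.diag_apply, pauliOp_apply, left_eq_add]
  by_cases ha : a = 0
  · simp only [ha, if_true, true_and, ← Finset.mul_sum, sum_signOf_dotProduct, mul_ite, mul_zero]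
  · simp [ha]

theorem pauliOp_eq_smul {n : ℕ} (c c' : ZMod 4) (a b : Bits n) :
    pauliOp c a b = (Complex.I ^ (c - c').val) • pauliOp c' a b := by
  rw [pauliOp, pauliOp, smul_smul, ← pow_add, ← I_pow_zmod (_ + _)]
  congr 3
  push_cast
  simp

theorem pauliX_mem_unitaryGroup {n : ℕ} (a : Bits n) :
    pauliX a ∈ Matrix.unitaryGroup (Bits n) ℂ := by
  have hX : pauliX a = pauliOp 0 a 0 := by
    ext y x
    simp [pauliOp_apply, pauliX, signOf]
  have h : star (pauliX a) = pauliX a := by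
    ext y x
    have : x = y + a ↔ y = x + a := by
      constructor <;> rintro rfl <;> rw [add_assoc, bits_add_self, add_zero]
    simp [pauliX, this, apply_ite]
  rw [Matrix.mem_unitaryGroup_iff, h, hX, pauliOp_mul, bits_add_self, ← pauliOp_one]
  simp

theorem pauliOp_mem_unitaryGroup {n : ℕ} (c : ZMod 4) (a b : Bits n) :
    pauliOp c a b ∈ Matrix.unitaryGroup (Bits n) ℂ := by
  have h := mul_mem (pauliX_mem_unitaryGroup a) (pauliZ_mem_unitaryGroup b)
  rw [Matrix.mem_unitaryGroup_iff] at h ⊢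
  rw [pauliOp, star_smul, smul_mul_smul_comm, h]
  simp [← mul_pow]

/-- Pick `x`, `y` in the supports of `s` and `t` and shift by `a = y + x`. If every `b` gave zero,
Fourier inversion over `b` would isolate the single term `star t y * s x`, which is nonzero. -/
theorem exists_pauliOp_dotProduct_ne_zero {n : ℕ} {s t : Bits n → ℂ} (hs : s ≠ 0) (ht : t ≠ 0) :
    ∃ a b : Bits n, star t ⬝ᵥ (pauliOp 0 a b *ᵥ s) ≠ 0 := by
  obtain ⟨x, hx⟩ := Function.ne_iff.mp hs
  obtain ⟨y, hy⟩ := Function.ne_iff.mp ht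
  by_contra! h
  have hmul : ∀ b z, (pauliOp 0 (y + x) b *ᵥ s) z =
      signOf (b ⬝ᵥ (z + (y + x))) * s (z + (y + x)) := by
    intro b z
    rw [Matrix.mulVec, dotProduct, Finset.sum_eq_single (z + (y + x))]
    · rw [pauliOp_apply, if_pos (by rw [add_assoc, bits_add_self, add_zero])]
      simp
    · intro w _ hw
      rw [pauliOp_apply, if_neg, zero_mul]
      rintro rfl
      exact hw (by rw [add_assoc w, bits_add_self, add_zero])
    · simp
  have h0 : ∑ b : Bits n, signOf (b ⬝ᵥ x) * (star t ⬝ᵥ (pauliOp 0 (y + x) b *ᵥ s)) = 0 :=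
    Finset.sum_eq_zero fun b _ => by rw [h, mul_zero]
  simp only [dotProduct.eq_1 (star t), hmul, Finset.mul_sum] at h0
  rw [Finset.sum_comm] at h0
  have h2 : ∀ z : Bits n, ∑ b : Bits n, signOf (b ⬝ᵥ x) *
      (star t z * (signOf (b ⬝ᵥ (z + (y + x))) * s (z + (y + x)))) =
      if z = y then star t y * s x * 2 ^ n else 0 := by
    intro z
    have : ∀ b : Bits n, signOf (b ⬝ᵥ x) *
      (star t z * (signOf (b ⬝ᵥ (z + (y + x))) * s (z + (y + x)))) =
      (star t z * s (z + (y + x))) * signOf ((z + y) ⬝ᵥ b) := by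
      intro b
      have e : (z + y) ⬝ᵥ b = b ⬝ᵥ x + b ⬝ᵥ (z + (y + x)) := by
        rw [← dotProduct_add, dotProduct_comm]
        congr 1
        rw [show x + (z + (y + x)) = z + y + (x + x) by abel, bits_add_self, add_zero]
      rw [e, signOf_add]
      ring
    simp only [this, ← Finset.mul_sum, sum_signOf_dotProduct]
    have hz : z + y = 0 ↔ z = y := by
      constructor
      · intro hzy
        rw [← add_zero z, ← bits_add_self y, ← add_assoc, hzy, zero_add]
      · rintro rfl
        exact bits_add_self z
    by_cases e : z = y
    · subst e
      simp [bits_add_self, ← add_assoc]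
    · simp [hz, e]
  simp only [h2, Finset.sum_ite_eq', Finset.mem_univ, if_true] at h0
  simp_all

theorem exists_smul_mul_comm_of_mem_pauliGroup {n : ℕ} {U V : Matrix.unitaryGroup (Bits n) ℂ}
    (hU : U ∈ pauliGroup n) (hV : V ∈ pauliGroup n) :
    ∃ z : ℂ, (U * V : Matrix (Bits n) (Bits n) ℂ) = z • (V * U : Matrix (Bits n) (Bits n) ℂ) := by
  obtain ⟨c, a, b, hU⟩ := hU
  obtain ⟨c', a', b', hV⟩ := hV
  rw [hU, hV, pauliOp_mul, pauliOp_mul, add_comm a', add_comm b']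
  exact ⟨_, pauliOp_eq_smul _ _ _ _⟩

theorem star_mulVec_dotProduct_mulVec {n : ℕ} (U : Matrix.unitaryGroup (Bits n) ℂ)
    (v w : Bits n → ℂ) :
    star ((U : Matrix (Bits n) (Bits n) ℂ) *ᵥ v) ⬝ᵥ ((U : Matrix (Bits n) (Bits n) ℂ) *ᵥ w) =
      star v ⬝ᵥ w := by
  rw [Matrix.star_mulVec, Matrix.dotProduct_mulVec, Matrix.vecMul_vecMul,
    ← Matrix.star_eq_conjTranspose, Matrix.mem_unitaryGroup_iff'.mp U.2, Matrix.vecMul_one]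

theorem star_mulVec_dotProduct {n : ℕ} (U : Matrix.unitaryGroup (Bits n) ℂ)
    (v w : Bits n → ℂ) :
    star ((U : Matrix (Bits n) (Bits n) ℂ) *ᵥ v) ⬝ᵥ w =
      star v ⬝ᵥ (((U⁻¹ : Matrix.unitaryGroup (Bits n) ℂ) : Matrix (Bits n) (Bits n) ℂ) *ᵥ w) := by
  rw [Matrix.star_mulVec, Matrix.dotProduct_mulVec]
  rfl

/-! ### Finite groups of Paulis attached to a state -/

instance finite_pauliGroup (n : ℕ) : Finite (pauliGroup n) := by
  have hfin : (Set.range fun q : ZMod 4 × Bits n × Bits n =>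
      pauliOp q.1 q.2.1 q.2.2).Finite := Set.finite_range _
  refine Set.Finite.to_subtype (s := (pauliGroup n : Set (Matrix.unitaryGroup (Bits n) ℂ)))
    ((hfin.preimage (f := fun U : Matrix.unitaryGroup (Bits n) ℂ =>
    (U : Matrix (Bits n) (Bits n) ℂ)) Subtype.val_injective.injOn).subset ?_)
  rintro U ⟨c, a, b, h⟩
  exact ⟨(c, a, b), h.symm⟩

theorem finite_of_le_pauliGroup {n : ℕ} {S : Subgroup (Matrix.unitaryGroup (Bits n) ℂ)}
    (h : S ≤ pauliGroup n) : Finite S :=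
  Finite.of_injective _ (Subgroup.inclusion_injective h)

/-- `S` is a group of `2 ^ n` Pauli operators fixing the unit vector `s`. -/
structure Stabilizes {n : ℕ} (S : Subgroup (Matrix.unitaryGroup (Bits n) ℂ))
    (s : Bits n → ℂ) : Prop where
  le : S ≤ pauliGroup n
  card : Nat.card S = 2 ^ n
  fixed : ∀ p ∈ S, (p : Matrix (Bits n) (Bits n) ℂ) *ᵥ s = s
  unit : star s ⬝ᵥ s = 1

/-- The Pauli operators having `s` as an eigenvector. -/
def pauliEigenGroup {n : ℕ} (s : Bits n → ℂ) : Subgroup (Matrix.unitaryGroup (Bits n) ℂ) where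
  carrier := {U | U ∈ pauliGroup n ∧
    ∃ z : ℂ, (U : Matrix (Bits n) (Bits n) ℂ) *ᵥ s = z • s}
  one_mem' := ⟨one_mem _, 1, by simp⟩
  mul_mem' := by
    rintro U V ⟨hU, z, hz⟩ ⟨hV, w, hw⟩
    refine ⟨mul_mem hU hV, w * z, ?_⟩
    rw [Submonoid.coe_mul, ← Matrix.mulVec_mulVec, hw, Matrix.mulVec_smul, hz, smul_smul]
  inv_mem' := by
    rintro U ⟨hU, z, hz⟩
    have h : s = z • (((U⁻¹ : Matrix.unitaryGroup (Bits n) ℂ) : Matrix (Bits n) (Bits n) ℂ) *ᵥ s) := by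
      rw [← Matrix.mulVec_smul, ← hz, Matrix.mulVec_mulVec, ← Submonoid.coe_mul, inv_mul_cancel]
      simp
    refine ⟨inv_mem hU, z⁻¹, ?_⟩
    by_cases h0 : z = 0
    · rw [h0, zero_smul] at h
      simp [h]
    · conv_rhs => rw [h]
      rw [smul_smul, inv_mul_cancel₀ h0, one_smul]

theorem pauliEigenGroup_le {n : ℕ} (s : Bits n → ℂ) : pauliEigenGroup s ≤ pauliGroup n :=
  fun _ h => h.1

/-- The index of `A ∩ B ∩ C` in `B ∩ C` is at most that of `A ∩ B` in `B`. This is the source of the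
approximate transitivity of closeness. -/
theorem Subgroup.card_inf_mul_card_inf_le_card_inf_mul_card {G : Type*} [Group G]
    (A B C : Subgroup G) [Finite A] [Finite B] :
    Nat.card (A ⊓ B : Subgroup G) * Nat.card (B ⊓ C : Subgroup G) ≤
      Nat.card (A ⊓ C : Subgroup G) * Nat.card B := by
  have hAC : Finite (A ⊓ C : Subgroup G) :=
    Finite.of_injective _ (Subgroup.inclusion_injective (inf_le_left : A ⊓ C ≤ A))
  have e1 : Nat.card (A ⊓ B : Subgroup G) * A.relIndex B = Nat.card B := by
    have := Subgroup.relIndex_mul_relIndex ⊥ (A ⊓ B) B bot_le inf_le_right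
    rwa [Subgroup.relIndex_bot_left, Subgroup.relIndex_bot_left,
      Subgroup.inf_relIndex_right] at this
  have e2 : Nat.card (A ⊓ C ⊓ B : Subgroup G) * A.relIndex (B ⊓ C) =
      Nat.card (B ⊓ C : Subgroup G) := by
    have := Subgroup.relIndex_mul_relIndex ⊥ (A ⊓ (B ⊓ C)) (B ⊓ C) bot_le inf_le_right
    rw [Subgroup.relIndex_bot_left, Subgroup.relIndex_bot_left,
      Subgroup.inf_relIndex_right] at this
    rwa [inf_assoc, inf_comm C]
  have hfin : A.relIndex B ≠ 0 := by
    intro h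
    rw [h, mul_zero] at e1
    exact Nat.card_pos.ne e1
  have e3 : A.relIndex (B ⊓ C) ≤ A.relIndex B :=
    Subgroup.relIndex_le_of_le_right inf_le_left hfin
  have e4 : Nat.card (A ⊓ C ⊓ B : Subgroup G) ≤ Nat.card (A ⊓ C : Subgroup G) :=
    Subgroup.card_le_of_le inf_le_left
  rw [← e2, ← e1]
  calc _ ≤ Nat.card (A ⊓ B : Subgroup G) * (Nat.card (A ⊓ C : Subgroup G) * A.relIndex B) := by
        gcongr
    _ = _ := by ring

theorem norm_dotProduct_le_one {ι : Type*} [Fintype ι] {v w : ι → ℂ} (hv : star v ⬝ᵥ v = 1)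
    (hw : star w ⬝ᵥ w = 1) : ‖star v ⬝ᵥ w‖ ≤ 1 := by
  have h := norm_inner_le_norm (𝕜 := ℂ) (WithLp.toLp 2 v) (WithLp.toLp 2 w)
  have hn : ∀ u : ι → ℂ, star u ⬝ᵥ u = 1 → ‖WithLp.toLp 2 u‖ = 1 := by
    intro u hu
    have h1 := inner_self_eq_norm_sq_to_K (𝕜 := ℂ) (WithLp.toLp 2 u)
    rw [EuclideanSpace.inner_eq_star_dotProduct, dotProduct_comm, hu] at h1
    have h2 : ‖WithLp.toLp 2 u‖ ^ 2 = 1 := by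
      have : ((‖WithLp.toLp 2 u‖ ^ 2 : ℝ) : ℂ) = 1 := by
        rw [h1]
        push_cast
        rfl
      exact_mod_cast this
    exact (pow_eq_one_iff_of_nonneg (norm_nonneg _) two_ne_zero).mp h2
  rw [hn v hv, hn w hw, one_mul, EuclideanSpace.inner_eq_star_dotProduct, dotProduct_comm] at h
  exact h

/-! ### Overlaps of stabilizer states -/

namespace Stabilizes

variable {n : ℕ} {S T : Subgroup (Matrix.unitaryGroup (Bits n) ℂ)} {s t : Bits n → ℂ}

theorem ne_zero (h : Stabilizes S s) : s ≠ 0 := by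
  rintro rfl
  simpa using h.unit

theorem le_pauliEigenGroup (h : Stabilizes S s) : S ≤ pauliEigenGroup s :=
  fun p hp => ⟨h.le hp, 1, by rw [h.fixed p hp, one_smul]⟩

/-- Only scalar Paulis have nonzero trace, and a scalar fixing `s ≠ 0` is the identity. -/
theorem trace_eq (h : Stabilizes S s) (p : S) :
    ((p : Matrix.unitaryGroup (Bits n) ℂ) : Matrix (Bits n) (Bits n) ℂ).trace =
      if p = 1 then 2 ^ n else 0 := by
  split_ifs with h1
  · subst h1
    simp [Matrix.trace_one]
  · obtain ⟨c, a, b, hp⟩ := h.le p.2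
    rw [hp, trace_pauliOp, if_neg]
    rintro ⟨rfl, rfl⟩
    apply h1
    have hsc : pauliOp c 0 0 = Complex.I ^ c.val • (1 : Matrix (Bits n) (Bits n) ℂ) := by
      rw [pauliOp_eq_smul c 0, pauliOp_one, sub_zero]
    have hf := h.fixed p p.2
    rw [hp, hsc, Matrix.smul_mulVec, Matrix.one_mulVec] at hf
    have hc : Complex.I ^ c.val = 1 := by
      have : (Complex.I ^ c.val - 1) • s = 0 := by rw [sub_smul, hf, one_smul, sub_self]
      exact sub_eq_zero.mp ((smul_eq_zero.mp this).resolve_right h.ne_zero)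
    rw [hc, one_smul] at hsc
    exact Subtype.ext (Subtype.ext (hp.trans hsc))

open scoped ComplexOrder in
/-- The average of the stabilizer group is the orthogonal projection onto the state. -/
theorem sum_eq (h : Stabilizes S s) [Fintype S] :
    ∑ p : S, ((p : Matrix.unitaryGroup (Bits n) ℂ) : Matrix (Bits n) (Bits n) ℂ) =
      (2 : ℂ) ^ n • Matrix.vecMulVec s (star s) := by
  set Q := ∑ p : S, ((p : Matrix.unitaryGroup (Bits n) ℂ) : Matrix (Bits n) (Bits n) ℂ) with hQ
  set R := Matrix.vecMulVec s (star s) with hR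
  have hcard : (Fintype.card S : ℂ) = 2 ^ n := by
    rw [← Nat.card_eq_fintype_card, h.card]; norm_num
  have hQQ : Q * Q = (2 : ℂ) ^ n • Q := by
    have : ∀ p : S, ((p : Matrix.unitaryGroup (Bits n) ℂ) : Matrix (Bits n) (Bits n) ℂ) * Q = Q := by
      intro p
      rw [hQ, Finset.mul_sum]
      exact Equiv.sum_comp (Equiv.mulLeft p) (fun q : S =>
        ((q : Matrix.unitaryGroup (Bits n) ℂ) : Matrix (Bits n) (Bits n) ℂ))
    conv_lhs => rw [hQ, Finset.sum_mul]
    simp only [← hQ, this, Finset.sum_const, Finset.card_univ]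
    rw [← hcard, Nat.cast_smul_eq_nsmul]
  have hQs : Qᴴ = Q := by
    rw [hQ, Matrix.conjTranspose_sum]
    exact Equiv.sum_comp (Equiv.inv S) (fun q : S =>
        ((q : Matrix.unitaryGroup (Bits n) ℂ) : Matrix (Bits n) (Bits n) ℂ))
  have hQt : Q.trace = 2 ^ n := by
    rw [hQ, Matrix.trace_sum]
    simp [h.trace_eq]
  have hQv : Q *ᵥ s = (2 : ℂ) ^ n • s := by
    rw [hQ, Matrix.sum_mulVec]
    simp only [h.fixed _ (Subtype.prop _), Finset.sum_const, Finset.card_univ]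
    rw [← hcard, Nat.cast_smul_eq_nsmul]
  have hRs : Rᴴ = R := by simp [hR, Matrix.conjTranspose_vecMulVec]
  have hQR : Q * R = (2 : ℂ) ^ n • R := by
    rw [hR, Matrix.mul_vecMulVec, hQv, Matrix.smul_vecMulVec]
  have hRQ : R * Q = (2 : ℂ) ^ n • R := by
    have := congrArg Matrix.conjTranspose hQR
    rw [Matrix.conjTranspose_mul, hQs, hRs, Matrix.conjTranspose_smul, hRs] at this
    simpa using this
  have hRR : R * R = R := by
    rw [hR, Matrix.vecMulVec_mul_vecMulVec, h.unit]
    simp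
  have hRt : R.trace = 1 := by
    rw [hR, Matrix.trace_vecMulVec, dotProduct_comm, h.unit]
  -- The squared Hilbert–Schmidt norm of the difference is `4^n - 4^n - 4^n + 4^n`.
  have key : ((Q - (2 : ℂ) ^ n • R)ᴴ * (Q - (2 : ℂ) ^ n • R)).trace = 0 := by
    have : (Q - (2 : ℂ) ^ n • R)ᴴ = Q - (2 : ℂ) ^ n • R := by
      rw [Matrix.conjTranspose_sub, Matrix.conjTranspose_smul, hQs, hRs]
      simp
    rw [this, sub_mul, mul_sub, mul_sub, hQQ, Matrix.mul_smul, hQR, Matrix.smul_mul, hRQ,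
      Matrix.smul_mul, Matrix.mul_smul, hRR]
    simp [hQt, hRt]
  exact sub_eq_zero.mp (Matrix.trace_conjTranspose_mul_self_eq_zero_iff.mp key)

theorem sum_mulVec (h : Stabilizes S s) [Fintype S] (v : Bits n → ℂ) :
    ∑ p : S, ((p : Matrix.unitaryGroup (Bits n) ℂ) : Matrix (Bits n) (Bits n) ℂ) *ᵥ v =
      ((2 : ℂ) ^ n * (star s ⬝ᵥ v)) • s := by
  rw [← Matrix.sum_mulVec, h.sum_eq, Matrix.smul_mulVec, Matrix.vecMulVec_mulVec, mul_smul]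
  simp

theorem eq_smul_of_fixed (h : Stabilizes S s) {v : Bits n → ℂ}
    (hv : ∀ p ∈ S, (p : Matrix (Bits n) (Bits n) ℂ) *ᵥ v = v) : v = (star s ⬝ᵥ v) • s := by
  have := finite_of_le_pauliGroup h.le
  have := Fintype.ofFinite S
  have h1 := h.sum_mulVec v
  simp only [hv _ (Subtype.prop _), Finset.sum_const, Finset.card_univ] at h1
  rw [← Nat.card_eq_fintype_card, h.card, ← Nat.cast_smul_eq_nsmul ℂ, mul_smul] at h1
  push_cast at h1
  exact smul_right_injective _ (pow_ne_zero n two_ne_zero) h1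

/-- By `sum_eq`, `2^n ⟨s, U s⟩` is the sum of the traces of `U q` over `q ∈ S`. If it is nonzero,
some `U q` has nonzero trace and is therefore a power of `i`. -/
theorem exists_eq_smul (h : Stabilizes S s) {U : Matrix.unitaryGroup (Bits n) ℂ}
    (hU : U ∈ pauliGroup n) (hs : star s ⬝ᵥ ((U : Matrix (Bits n) (Bits n) ℂ) *ᵥ s) ≠ 0) :
    ∃ c : ZMod 4, ∃ q ∈ S,
      (U : Matrix (Bits n) (Bits n) ℂ) = Complex.I ^ c.val • (q : Matrix (Bits n) (Bits n) ℂ) := by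
  have := finite_of_le_pauliGroup h.le
  have := Fintype.ofFinite S
  have h1 : ((U : Matrix (Bits n) (Bits n) ℂ) * ((2 : ℂ) ^ n • Matrix.vecMulVec s (star s))).trace
      ≠ 0 := by
    rw [Matrix.mul_smul, Matrix.mul_vecMulVec, Matrix.trace_smul, Matrix.trace_vecMulVec,
      dotProduct_comm]
    exact smul_ne_zero (pow_ne_zero n two_ne_zero) hs
  rw [← h.sum_eq, Finset.mul_sum, Matrix.trace_sum] at h1
  obtain ⟨q, -, hq⟩ := Finset.exists_ne_zero_of_sum_ne_zero h1
  obtain ⟨c, a, b, hUq⟩ := mul_mem hU (h.le q.2)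
  rw [Submonoid.coe_mul] at hUq
  rw [hUq, trace_pauliOp] at hq
  obtain ⟨rfl, rfl⟩ : a = 0 ∧ b = 0 := by
    by_contra hab
    exact hq (if_neg hab)
  refine ⟨c, q⁻¹, inv_mem q.2, ?_⟩
  have h2 : (U : Matrix (Bits n) (Bits n) ℂ) =
      (U * q.1 * q.1⁻¹ : Matrix.unitaryGroup (Bits n) ℂ) := by
    rw [mul_inv_cancel_right]
  rw [h2, Submonoid.coe_mul, Submonoid.coe_mul, hUq, pauliOp_eq_smul c 0, pauliOp_one, sub_zero,
    Matrix.smul_mul, one_mul]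

theorem dotProduct_mulVec_eq (h : Stabilizes S s) {U : Matrix.unitaryGroup (Bits n) ℂ}
    (hU : U ∈ pauliGroup n) :
    star s ⬝ᵥ ((U : Matrix (Bits n) (Bits n) ℂ) *ᵥ s) = 0 ∨
    ∃ c : ZMod 4, star s ⬝ᵥ ((U : Matrix (Bits n) (Bits n) ℂ) *ᵥ s) = Complex.I ^ c.val ∧
      (U : Matrix (Bits n) (Bits n) ℂ) *ᵥ s = Complex.I ^ c.val • s := by
  by_cases h0 : star s ⬝ᵥ ((U : Matrix (Bits n) (Bits n) ℂ) *ᵥ s) = 0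
  · exact Or.inl h0
  · obtain ⟨c, q, hq, e⟩ := h.exists_eq_smul hU h0
    have e2 : (U : Matrix (Bits n) (Bits n) ℂ) *ᵥ s = Complex.I ^ c.val • s := by
      rw [e, Matrix.smul_mulVec, h.fixed q hq]
    refine Or.inr ⟨c, ?_, e2⟩
    rw [e2, dotProduct_smul, h.unit, smul_eq_mul, mul_one]

/-- A Pauli with eigenvector `t` is an element of `T` times one of four phases, and phases do not
affect having `s` as an eigenvector. -/
theorem card_inf_pauliEigenGroup_le (h : Stabilizes T t) (s : Bits n → ℂ) :
    Nat.card (pauliEigenGroup t ⊓ pauliEigenGroup s : Subgroup _) ≤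
      4 * Nat.card (T ⊓ pauliEigenGroup s : Subgroup _) := by
  have := finite_of_le_pauliGroup (inf_le_left.trans h.le : T ⊓ pauliEigenGroup s ≤ _)
  have key : ∀ U : (pauliEigenGroup t ⊓ pauliEigenGroup s : Subgroup _),
      ∃ x : ZMod 4 × (T ⊓ pauliEigenGroup s : Subgroup _),
        (U.1 : Matrix (Bits n) (Bits n) ℂ) =
          Complex.I ^ x.1.val • (x.2.1 : Matrix (Bits n) (Bits n) ℂ) := by
    rintro ⟨U, ⟨hU, z, hz⟩, -, w, hw⟩
    have hz0 : z ≠ 0 := by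
      rintro rfl
      have h1 := star_mulVec_dotProduct_mulVec U t t
      rw [hz, h.unit] at h1
      simp at h1
    obtain ⟨c, q, hq, e⟩ := h.exists_eq_smul hU (by
      rw [hz, dotProduct_smul, h.unit]; simpa using hz0)
    refine ⟨(c, ⟨q, hq, h.le hq, (Complex.I ^ c.val)⁻¹ * w, ?_⟩), e⟩
    rw [mul_smul, ← hw, e, Matrix.smul_mulVec, smul_smul, inv_mul_cancel₀ (by simp), one_smul]
  choose f hf using key
  have hinj : Function.Injective f := by
    intro U V hUV
    exact Subtype.ext (Subtype.ext (by rw [hf, hf, hUV]))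
  have := Nat.card_le_card_of_injective f hinj
  rwa [Nat.card_prod, Nat.card_zmod] at this

theorem card_pauliEigenGroup_le (h : Stabilizes T t) :
    Nat.card (pauliEigenGroup t) ≤ 4 * 2 ^ n := by
  have := h.card_inf_pauliEigenGroup_le t
  rwa [inf_idem, inf_eq_left.mpr h.le_pauliEigenGroup, h.card] at this

theorem le_card_pauliEigenGroup (h : Stabilizes T t) :
    2 ^ n ≤ Nat.card (pauliEigenGroup t) := by
  have := finite_of_le_pauliGroup (pauliEigenGroup_le t)
  rw [← h.card]
  exact Subgroup.card_le_of_le h.le_pauliEigenGroup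

/-- Averaging over `T` gives `2^n |⟨s, t⟩|² = ∑ ⟨s, p s⟩` over `p ∈ T`. Each term is `0` or of
modulus one, the latter only for `p` in the eigengroup of `s`. -/
theorem norm_dotProduct_sq_le (hs : Stabilizes S s) (ht : Stabilizes T t) :
    ‖star s ⬝ᵥ t‖ ^ 2 * 2 ^ n ≤ Nat.card (pauliEigenGroup s ⊓ pauliEigenGroup t : Subgroup _) := by
  classical
  have := finite_of_le_pauliGroup ht.le
  have := finite_of_le_pauliGroup (inf_le_left.trans (pauliEigenGroup_le s) :
    pauliEigenGroup s ⊓ pauliEigenGroup t ≤ _)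
  have := Fintype.ofFinite T
  have h1 : star s ⬝ᵥ ∑ p : T, (p.1 : Matrix (Bits n) (Bits n) ℂ) *ᵥ s =
      (2 : ℂ) ^ n * (starRingEnd ℂ (star s ⬝ᵥ t) * (star s ⬝ᵥ t)) := by
    rw [ht.sum_mulVec, dotProduct_smul, smul_eq_mul, mul_assoc]
    congr 2
    rw [starRingEnd_apply, Matrix.star_dotProduct, dotProduct_comm]
  have h2 : ‖star s ⬝ᵥ t‖ ^ 2 * 2 ^ n =
      ‖∑ p : T, star s ⬝ᵥ ((p.1 : Matrix (Bits n) (Bits n) ℂ) *ᵥ s)‖ := by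
    rw [← dotProduct_sum, h1]
    simp
    ring
  rw [h2]
  have h3 : ∀ p : T, ‖star s ⬝ᵥ ((p.1 : Matrix (Bits n) (Bits n) ℂ) *ᵥ s)‖ ≤
      if p.1 ∈ pauliEigenGroup s then 1 else 0 := by
    intro p
    rcases hs.dotProduct_mulVec_eq (ht.le p.2) with h0 | ⟨c, h0, hc⟩
    · rw [h0]
      split_ifs <;> simp
    · rw [if_pos ⟨ht.le p.2, _, hc⟩, h0]
      simp
  refine (norm_sum_le_of_le _ fun p _ => h3 p).trans ?_
  rw [Finset.sum_boole, Nat.cast_le, ← Fintype.card_subtype, ← Nat.card_eq_fintype_card]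
  refine Nat.card_le_card_of_injective (fun p => ⟨p.1.1, p.2, ht.le_pauliEigenGroup p.1.2⟩) ?_
  intro p q hpq
  exact Subtype.ext (Subtype.ext (congrArg (fun U => U.1) hpq))

theorem card_inf_mul_card_inf_le (ht : Stabilizes T t) (s u : Bits n → ℂ) :
    Nat.card (pauliEigenGroup s ⊓ pauliEigenGroup t : Subgroup _) *
      Nat.card (pauliEigenGroup t ⊓ pauliEigenGroup u : Subgroup _) ≤
    Nat.card (pauliEigenGroup s ⊓ pauliEigenGroup u : Subgroup _) * (4 * 2 ^ n) := by
  have := finite_of_le_pauliGroup (pauliEigenGroup_le t)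
  have := finite_of_le_pauliGroup (pauliEigenGroup_le s)
  exact (Subgroup.card_inf_mul_card_inf_le_card_inf_mul_card _ _ _).trans
    (Nat.mul_le_mul_left _ ht.card_pauliEigenGroup_le)

/-- A nonzero multiple of `t` is a sum of few Pauli images of `s`. -/
theorem exists_smul_eq_sum (hs : Stabilizes S s) (ht : Stabilizes T t) :
    ∃ (α : ℂ) (O : Finset (Bits n → ℂ)), α ≠ 0 ∧ α • t = ∑ x ∈ O, x ∧
      (∀ x ∈ O, ∃ U ∈ pauliGroup n, x = (U : Matrix (Bits n) (Bits n) ℂ) *ᵥ s) ∧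
      ‖α‖ ≤ O.card ∧
      O.card * Nat.card (pauliEigenGroup s ⊓ pauliEigenGroup t : Subgroup _) ≤ 4 * 2 ^ n := by
  classical
  have := finite_of_le_pauliGroup ht.le
  have := finite_of_le_pauliGroup (inf_le_left.trans ht.le : T ⊓ pauliEigenGroup s ≤ _)
  have := Fintype.ofFinite T
  have := Fintype.ofFinite (T ⊓ pauliEigenGroup s : Subgroup _)
  -- The sum over the `T`-orbit of `w = P s` is `T`-invariant, hence a multiple of `t`; the choice
  -- of `P` makes it nonzero.
  obtain ⟨a, b, hab⟩ := exists_pauliOp_dotProduct_ne_zero hs.ne_zero ht.ne_zero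
  set P : Matrix.unitaryGroup (Bits n) ℂ := ⟨pauliOp 0 a b, pauliOp_mem_unitaryGroup 0 a b⟩
  have hP : P ∈ pauliGroup n := ⟨0, a, b, rfl⟩
  set w := (P : Matrix (Bits n) (Bits n) ℂ) *ᵥ s with hw
  have hw0 : star t ⬝ᵥ w ≠ 0 := hab
  have htx : ∀ p ∈ T, star t ⬝ᵥ ((p : Matrix (Bits n) (Bits n) ℂ) *ᵥ w) = star t ⬝ᵥ w := by
    intro p hp
    have := star_mulVec_dotProduct p⁻¹ t w
    rw [inv_inv, ht.fixed _ (inv_mem hp)] at this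
    exact this.symm
  -- Paulis commute up to a scalar, so `p` multiplies `w` by a scalar; comparing overlaps with `t`
  -- shows the scalar is `1`.
  have hstab : ∀ p ∈ T ⊓ pauliEigenGroup s, (p : Matrix (Bits n) (Bits n) ℂ) *ᵥ w = w := by
    rintro p ⟨hp, -, z, hz⟩
    obtain ⟨y, hy⟩ := exists_smul_mul_comm_of_mem_pauliGroup (ht.le hp) hP
    have h1 : (p : Matrix (Bits n) (Bits n) ℂ) *ᵥ w = (y * z) • w := by
      rw [hw, Matrix.mulVec_mulVec, hy, Matrix.smul_mulVec, ← Matrix.mulVec_mulVec, hz,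
        Matrix.mulVec_smul, smul_smul]
    have h2 := htx p hp
    rw [h1, dotProduct_smul, smul_eq_mul] at h2
    rw [h1, mul_right_cancel₀ hw0 (h2.trans (one_mul _).symm), one_smul]
  set O : Finset (Bits n → ℂ) :=
    Finset.univ.image fun p : T => (p.1 : Matrix (Bits n) (Bits n) ℂ) *ᵥ w with hO
  have hmem : ∀ p ∈ T, ∀ x ∈ O, (p : Matrix (Bits n) (Bits n) ℂ) *ᵥ x ∈ O := by
    intro p hp x hx
    obtain ⟨q, -, rfl⟩ := Finset.mem_image.mp hx
    refine Finset.mem_image.mpr ⟨⟨p, hp⟩ * q, Finset.mem_univ _, ?_⟩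
    rw [Subgroup.coe_mul, Submonoid.coe_mul, ← Matrix.mulVec_mulVec]
  have hcancel : ∀ (p : Matrix.unitaryGroup (Bits n) ℂ) (x : Bits n → ℂ),
      ((p⁻¹ : Matrix.unitaryGroup (Bits n) ℂ) : Matrix (Bits n) (Bits n) ℂ) *ᵥ
        ((p : Matrix (Bits n) (Bits n) ℂ) *ᵥ x) = x := by
    intro p x
    rw [Matrix.mulVec_mulVec, ← Submonoid.coe_mul, inv_mul_cancel]
    simp
  have hfix : ∀ p ∈ T, (p : Matrix (Bits n) (Bits n) ℂ) *ᵥ ∑ x ∈ O, x = ∑ x ∈ O, x := by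
    intro p hp
    rw [Matrix.mulVec_sum]
    refine Finset.sum_bij' (fun x _ => (p : Matrix (Bits n) (Bits n) ℂ) *ᵥ x)
      (fun x _ => ((p⁻¹ : Matrix.unitaryGroup (Bits n) ℂ) : Matrix (Bits n) (Bits n) ℂ) *ᵥ x)
      (hmem p hp) (hmem _ (inv_mem hp)) (fun x _ => hcancel p x) (fun x _ => ?_) fun _ _ => rfl
    conv_rhs => rw [← hcancel p⁻¹ x, inv_inv]
  have hα : star t ⬝ᵥ ∑ x ∈ O, x = O.card * (star t ⬝ᵥ w) := by
    rw [dotProduct_sum, ← nsmul_eq_mul, ← Finset.sum_const]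
    refine Finset.sum_congr rfl fun x hx => ?_
    obtain ⟨q, -, rfl⟩ := Finset.mem_image.mp hx
    exact htx _ q.2
  have hOne : O.Nonempty := Finset.univ_nonempty.image _
  refine ⟨star t ⬝ᵥ ∑ x ∈ O, x, O, ?_, (ht.eq_smul_of_fixed hfix).symm, ?_, ?_, ?_⟩
  · rw [hα]
    exact mul_ne_zero (Nat.cast_ne_zero.mpr hOne.card_pos.ne') hw0
  · intro x hx
    obtain ⟨q, -, rfl⟩ := Finset.mem_image.mp hx
    refine ⟨q * P, mul_mem (ht.le q.2) hP, ?_⟩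
    rw [hw, Matrix.mulVec_mulVec]
    rfl
  · rw [hα, norm_mul, Complex.norm_natCast]
    refine mul_le_of_le_one_right (Nat.cast_nonneg _) (norm_dotProduct_le_one ht.unit ?_)
    rw [hw, star_mulVec_dotProduct_mulVec, hs.unit]
  -- Each fibre of the orbit map `p ↦ p w` contains a coset of `T ⊓ pauliEigenGroup s`.
  · have h1 : O.card * Nat.card (T ⊓ pauliEigenGroup s : Subgroup _) ≤ 2 ^ n := by
      rw [← ht.card, Nat.card_eq_fintype_card (α := T), ← Finset.card_univ, Finset.card_eq_sum_card_image
        (fun p : T => (p.1 : Matrix (Bits n) (Bits n) ℂ) *ᵥ w), ← smul_eq_mul]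
      refine Finset.card_nsmul_le_sum _ _ _ fun x hx => ?_
      obtain ⟨p, -, rfl⟩ := Finset.mem_image.mp hx
      rw [Nat.card_eq_fintype_card, ← Finset.card_univ]
      refine Finset.card_le_card_of_injOn (fun q => p * ⟨q.1, q.2.1⟩) ?_ ?_
      · intro q _
        simp only [Finset.coe_filter, Set.mem_ofPred_eq, Finset.mem_univ, true_and]
        rw [Subgroup.coe_mul, Submonoid.coe_mul, ← Matrix.mulVec_mulVec, hstab _ q.2]
      · intro q _ q' _ h
        have := mul_left_cancel h
        exact Subtype.ext (congrArg (fun U : T => U.1) this)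
    have h2 := ht.card_inf_pauliEigenGroup_le s
    rw [inf_comm] at h2
    calc _ ≤ O.card * (4 * Nat.card (T ⊓ pauliEigenGroup s : Subgroup _)) := by gcongr
      _ = 4 * (O.card * Nat.card (T ⊓ pauliEigenGroup s : Subgroup _)) := by ring
      _ ≤ _ := by gcongr

/-- Each pair contributes `⟨U s, V s⟩ = ⟨s, U⁻¹ V s⟩`, which is `0` or a power of `i`. -/
theorem dotProduct_sum_mem (hs : Stabilizes S s) {O O' : Finset (Bits n → ℂ)}
    (hO : ∀ x ∈ O, ∃ U ∈ pauliGroup n, x = (U : Matrix (Bits n) (Bits n) ℂ) *ᵥ s)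
    (hO' : ∀ x ∈ O', ∃ U ∈ pauliGroup n, x = (U : Matrix (Bits n) (Bits n) ℂ) *ᵥ s) :
    star (∑ x ∈ O, x) ⬝ᵥ ∑ x ∈ O', x ∈ GaussianInt.toComplex.range := by
  rw [star_sum, sum_dotProduct]
  refine sum_mem fun x hx => ?_
  rw [dotProduct_sum]
  refine sum_mem fun y hy => ?_
  obtain ⟨U, hU, rfl⟩ := hO x hx
  obtain ⟨V, hV, rfl⟩ := hO' y hy
  rw [star_mulVec_dotProduct, Matrix.mulVec_mulVec, ← Submonoid.coe_mul]
  rcases hs.dotProduct_mulVec_eq (mul_mem (inv_mem hU) hV) with h | ⟨c, h, -⟩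
  · rw [h]
    exact zero_mem _
  · rw [h]
    have hI : Complex.I ∈ GaussianInt.toComplex.range :=
      RingHom.mem_range.mpr ⟨⟨0, 1⟩, by simp [GaussianInt.toComplex_def]⟩
    exact pow_mem hI _

end Stabilizes

/-! ### Uniform lower bounds for Gaussian integer forms -/

/-- A positive definite Hermitian form on `ℂ^ι` is bounded below. -/
theorem exists_pos_forall_le_form {ι : Type*} [Fintype ι] (Q : Matrix ι ι ℂ)
    (hQ : ∀ c : ι → ℂ, c ≠ 0 → 0 < (star c ⬝ᵥ (Q *ᵥ c)).re) :
    ∃ l : ℝ, 0 < l ∧ ∀ c : ι → ℂ, l * ∑ i, ‖c i‖ ^ 2 ≤ (star c ⬝ᵥ (Q *ᵥ c)).re := by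
  rcases isEmpty_or_nonempty ι with hι | hι
  · exact ⟨1, one_pos, fun c => by simp [dotProduct]⟩
  let f : EuclideanSpace ℂ ι → ℝ := fun c => (star c.ofLp ⬝ᵥ (Q *ᵥ c.ofLp)).re
  have hf : Continuous f := by
    simp only [f, dotProduct, Matrix.mulVec, Pi.star_apply]
    fun_prop
  obtain ⟨x, hx, hmin⟩ := (isCompact_sphere (0 : EuclideanSpace ℂ ι) 1).exists_isMinOn
    (NormedSpace.sphere_nonempty.mpr zero_le_one) hf.continuousOn
  have hx0 : x.ofLp ≠ 0 := by
    intro h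
    have : x = 0 := by ext i; exact congrFun h i
    simp [this] at hx
  refine ⟨f x, hQ _ hx0, fun c => ?_⟩
  by_cases hc : c = 0
  · simp [hc]
  set d : EuclideanSpace ℂ ι := WithLp.toLp 2 c with hd
  have hn : ‖d‖ ≠ 0 := by
    rw [norm_ne_zero_iff]
    intro h
    apply hc
    funext i
    exact congrArg (fun v : EuclideanSpace ℂ ι => v i) h
  have hsph : ((‖d‖⁻¹ : ℝ) : ℂ) • d ∈ Metric.sphere (0 : EuclideanSpace ℂ ι) 1 := by
    simp [norm_smul, hn]
  have h1 : f x ≤ _ := hmin hsph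
  have h2 : f (((‖d‖⁻¹ : ℝ) : ℂ) • d) = ‖d‖⁻¹ ^ 2 * (star c ⬝ᵥ (Q *ᵥ c)).re := by
    simp only [f, WithLp.ofLp_smul, star_smul, Matrix.mulVec_smul, smul_dotProduct,
      dotProduct_smul, smul_eq_mul, ← mul_assoc, hd]
    rw [Complex.star_def, Complex.conj_ofReal, ← Complex.ofReal_mul, Complex.re_ofReal_mul, sq]
  rw [h2, inv_pow, inv_mul_eq_div, le_div_iff₀ (by positivity)] at h1
  rwa [EuclideanSpace.norm_sq_eq] at h1

theorem finite_gaussianInt_norm_le (N : ℝ) :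
    {z : ℂ | z ∈ GaussianInt.toComplex.range ∧ ‖z‖ ≤ N}.Finite := by
  have hfin : ((fun p : ℤ × ℤ => GaussianInt.toComplex ⟨p.1, p.2⟩) ''
      (Set.Icc (-⌈N⌉) ⌈N⌉ ×ˢ Set.Icc (-⌈N⌉) ⌈N⌉)).Finite :=
    ((Set.finite_Icc _ _).prod (Set.finite_Icc _ _)).image _
  refine hfin.subset ?_
  rintro _ ⟨⟨z, rfl⟩, hz⟩
  have h1 : |(z.re : ℝ)| ≤ ⌈N⌉ := by
    have := Complex.abs_re_le_norm (GaussianInt.toComplex z)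
    rw [show (GaussianInt.toComplex z).re = z.re from GaussianInt.re_toComplex z.re z.im] at this
    exact this.trans (hz.trans (Int.le_ceil N))
  have h2 : |(z.im : ℝ)| ≤ ⌈N⌉ := by
    have := Complex.abs_im_le_norm (GaussianInt.toComplex z)
    rw [show (GaussianInt.toComplex z).im = z.im from GaussianInt.im_toComplex z.re z.im] at this
    exact this.trans (hz.trans (Int.le_ceil N))
  refine ⟨(z.re, z.im), ⟨?_, ?_⟩, rfl⟩
  · exact abs_le.mp (by exact_mod_cast h1)
  · exact abs_le.mp (by exact_mod_cast h2)

/-- Positive definite forms with bounded Gaussian integer entries are uniformly bounded below. -/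
theorem exists_pos_forall_gaussianInt_form (ι : Type*) [Fintype ι] (N : ℝ) :
    ∃ l : ℝ, 0 < l ∧ ∀ Q : Matrix ι ι ℂ,
      (∀ i j, Q i j ∈ GaussianInt.toComplex.range ∧ ‖Q i j‖ ≤ N) →
      (∀ c : ι → ℂ, c ≠ 0 → 0 < (star c ⬝ᵥ (Q *ᵥ c)).re) →
      ∀ c : ι → ℂ, l * ∑ i, ‖c i‖ ^ 2 ≤ (star c ⬝ᵥ (Q *ᵥ c)).re := by
  have hfin : {Q : Matrix ι ι ℂ |
      ∀ i j, Q i j ∈ GaussianInt.toComplex.range ∧ ‖Q i j‖ ≤ N}.Finite := by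
    have := Set.Finite.pi' fun _ : ι => Set.Finite.pi' fun _ : ι => finite_gaussianInt_norm_le N
    exact this
  -- Only finitely many matrices qualify, so the minimum of their individual bounds is positive.
  have key : ∀ F : Set (Matrix ι ι ℂ), F.Finite → ∃ l : ℝ, 0 < l ∧ ∀ Q ∈ F,
      (∀ c : ι → ℂ, c ≠ 0 → 0 < (star c ⬝ᵥ (Q *ᵥ c)).re) →
      ∀ c : ι → ℂ, l * ∑ i, ‖c i‖ ^ 2 ≤ (star c ⬝ᵥ (Q *ᵥ c)).re := by
    intro F hF
    induction F, hF using Set.Finite.induction_on with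
    | empty => exact ⟨1, one_pos, by simp⟩
    | @insert Q F _ _ ih =>
      obtain ⟨l, hl, h⟩ := ih
      by_cases hQ : ∀ c : ι → ℂ, c ≠ 0 → 0 < (star c ⬝ᵥ (Q *ᵥ c)).re
      · obtain ⟨l', hl', h'⟩ := exists_pos_forall_le_form Q hQ
        refine ⟨min l l', lt_min hl hl', ?_⟩
        rintro R (rfl | hR) hpos c
        · exact le_trans (by gcongr; exact min_le_right _ _) (h' c)
        · exact le_trans (by gcongr; exact min_le_left _ _) (h R hR hpos c)
      · refine ⟨l, hl, ?_⟩
        rintro R (rfl | hR) hpos c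
        · exact absurd hpos hQ
        · exact h R hR hpos c
  obtain ⟨l, hl, h⟩ := key _ hfin
  exact ⟨l, hl, fun Q hQ => h Q hQ⟩

/-! ### Scales and thresholds -/

/-- A monotone sequence of subsets of a finite type stagnates early. -/
theorem exists_le_card_eq_succ {α : Type*} [Fintype α] {A : ℕ → Finset α} (hA : Monotone A) :
    ∃ j ≤ Fintype.card α, A j = A (j + 1) := by
  by_contra! h
  have : ∀ j ≤ Fintype.card α + 1, j ≤ (A j).card := by
    intro j
    induction j with
    | zero => simp
    | succ j ih =>
      intro hj
      have h1 := ih (by omega)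
      have h2 := Finset.card_lt_card ((hA (Nat.le_add_right j 1)).lt_of_ne (h j (by omega)))
      omega
  have h1 := this _ le_rfl
  have h2 := (A (Fintype.card α + 1)).card_le_univ
  omega

/-- Thresholds that decrease so fast that, at each of them, inner products of norm at most the
square root of the next one are negligible. -/
theorem exists_thresholds (ι : Type*) [Fintype ι] :
    ∃ η l : ℕ → ℝ, (∀ j, 0 < η j ∧ η j ≤ 1) ∧ (∀ j, 0 < l j) ∧ Antitone η ∧
      (∀ j, 4 * η (j + 1) ≤ η j ^ 2) ∧
      (∀ j, (4 / η j) ^ 2 * √(η (j + 1)) * Fintype.card ι ≤ l j / 2) ∧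
      ∀ j, ∀ Q : Matrix ι ι ℂ,
      (∀ i i', Q i i' ∈ GaussianInt.toComplex.range ∧ ‖Q i i'‖ ≤ (4 / η j) ^ 2) →
      (∀ c : ι → ℂ, c ≠ 0 → 0 < (star c ⬝ᵥ (Q *ᵥ c)).re) →
      ∀ c : ι → ℂ, l j * ∑ i, ‖c i‖ ^ 2 ≤ (star c ⬝ᵥ (Q *ᵥ c)).re := by
  choose L hL hform using fun x : ℝ => exists_pos_forall_gaussianInt_form ι ((4 / x) ^ 2)
  -- The three terms give monotonicity, approximate transitivity and negligible off-block entries.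
  -- The `+ 1` keeps the denominator positive when `ι` is empty.
  let next : ℝ → ℝ := fun x => min (min x (x ^ 2 / 4))
    ((L x / 2 / ((4 / x) ^ 2 * (Fintype.card ι + 1))) ^ 2)
  let η : ℕ → ℝ := fun j => next^[j] 1
  have hsucc : ∀ j, η (j + 1) = next (η j) := fun j => Function.iterate_succ_apply' _ _ _
  have hpos : ∀ j, 0 < η j := by
    intro j
    induction j with
    | zero => exact one_pos
    | succ j ih =>
      rw [hsucc]
      have := hL (η j)
      refine lt_min (lt_min ih ?_) ?_ <;> positivity
  have hanti : Antitone η := antitone_nat_of_succ_le fun j => by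
    rw [hsucc]
    exact (min_le_left _ _).trans (min_le_left _ _)
  refine ⟨η, fun j => L (η j), fun j => ⟨hpos j, hanti (Nat.zero_le j)⟩, fun j => hL _, hanti,
    fun j => ?_, fun j => ?_, fun j => hform _⟩
  · have : η (j + 1) ≤ η j ^ 2 / 4 := by
      rw [hsucc]
      exact (min_le_left _ _).trans (min_le_right _ _)
    linarith
  · have h1 : η (j + 1) ≤ (L (η j) / 2 / ((4 / η j) ^ 2 * (Fintype.card ι + 1))) ^ 2 := by
      rw [hsucc]
      exact min_le_right _ _
    have hLj := hL (η j)
    have hj := hpos j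
    have h2 := Real.sqrt_le_sqrt h1
    rw [Real.sqrt_sq (by positivity)] at h2
    calc (4 / η j) ^ 2 * √(η (j + 1)) * Fintype.card ι
        ≤ (4 / η j) ^ 2 * (L (η j) / 2 / ((4 / η j) ^ 2 * (Fintype.card ι + 1))) *
          (Fintype.card ι + 1) := by
          gcongr
          linarith
      _ = L (η j) / 2 := by field_simp

/-! ### Conditioning of families that split into blocks -/

theorem star_dotProduct_mulVec_blockGram {ι E : Type*} [Fintype ι] [DecidableEq ι]
    [NormedAddCommGroup E] [InnerProductSpace ℂ E] (v : ι → E) (rep : ι → ι) (c : ι → ℂ) :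
    star c ⬝ᵥ (Matrix.of (fun i j => if rep i = rep j then inner ℂ (v i) (v j) else 0) *ᵥ c) =
      ∑ a, inner ℂ (∑ i, if rep i = a then c i • v i else 0)
        (∑ i, if rep i = a then c i • v i else 0) := by
  simp only [sum_inner]
  simp only [inner_sum]
  rw [Finset.sum_comm]
  simp only [dotProduct, Matrix.mulVec, Finset.mul_sum]
  refine Finset.sum_congr rfl fun i _ => ?_
  rw [Finset.sum_comm]
  refine Finset.sum_congr rfl fun j _ => ?_
  rw [Finset.sum_eq_single (rep i)]
  · by_cases h : rep i = rep j
    · simp [h, inner_smul_left, inner_smul_right]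
      ring
    · simp [h, Ne.symm h]
  · intro a _ ha
    simp [Ne.symm ha]
  · simp

/-- The off-block entries change the form by at most `ε (∑ |c i|)²`, which by Cauchy–Schwarz is at
most `ε |ι| ∑ |c i|²`, half of the block bound. -/
theorem sum_norm_sq_le_of_blockGram {ι E : Type*} [Fintype ι] [DecidableEq ι]
    [NormedAddCommGroup E] [InnerProductSpace ℂ E] (v : ι → E) (rep : ι → ι) (c : ι → ℂ)
    {l ε : ℝ} (hε : ε * Fintype.card ι ≤ l / 2)
    (hoff : ∀ i j, rep i ≠ rep j → ‖inner ℂ (v i) (v j)‖ ≤ ε) (hε0 : 0 ≤ ε)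
    (hl : l * ∑ i, ‖c i‖ ^ 2 ≤ (star c ⬝ᵥ (Matrix.of
      (fun i j => if rep i = rep j then inner ℂ (v i) (v j) else 0) *ᵥ c)).re) :
    l / 2 * ∑ i, ‖c i‖ ^ 2 ≤ ‖∑ i, c i • v i‖ ^ 2 := by
  set Q : Matrix ι ι ℂ := Matrix.of (fun i j => if rep i = rep j then inner ℂ (v i) (v j) else 0)
    with hQ
  have h1 : inner ℂ (∑ i, c i • v i) (∑ i, c i • v i) - star c ⬝ᵥ (Q *ᵥ c) =
      ∑ i, ∑ j, star (c i) * c j * (inner ℂ (v i) (v j) - Q i j) := by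
    simp only [sum_inner]
    simp only [inner_sum, dotProduct, Matrix.mulVec, Finset.mul_sum,
      ← Finset.sum_sub_distrib]
    refine Finset.sum_congr rfl fun i _ => Finset.sum_congr rfl fun j _ => ?_
    simp [inner_smul_left, inner_smul_right]
    ring
  have h2 : ‖inner ℂ (∑ i, c i • v i) (∑ i, c i • v i) - star c ⬝ᵥ (Q *ᵥ c)‖ ≤
      ε * (∑ i, ‖c i‖) ^ 2 := by
    rw [h1, sq, Finset.sum_mul_sum, Finset.mul_sum]
    refine norm_sum_le_of_le _ fun i _ => ?_
    rw [Finset.mul_sum]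
    refine norm_sum_le_of_le _ fun j _ => ?_
    have h3 : ‖inner ℂ (v i) (v j) - Q i j‖ ≤ ε := by
      by_cases h : rep i = rep j
      · simpa [hQ, h] using hε0
      · simpa [hQ, h] using hoff i j h
    rw [norm_mul, norm_mul, norm_star, mul_comm ε]
    gcongr
  have h4 : (∑ i, ‖c i‖) ^ 2 ≤ Fintype.card ι * ∑ i, ‖c i‖ ^ 2 :=
    sq_sum_le_card_mul_sum_sq
  have h5 := (abs_le.mp ((Complex.abs_re_le_norm _).trans h2)).1
  have h6 : (inner ℂ (∑ i, c i • v i) (∑ i, c i • v i) : ℂ).re = ‖∑ i, c i • v i‖ ^ 2 :=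
    inner_self_eq_norm_sq (𝕜 := ℂ) _
  rw [Complex.sub_re, h6] at h5
  have h7 : ε * (∑ i, ‖c i‖) ^ 2 ≤ l / 2 * ∑ i, ‖c i‖ ^ 2 :=
    calc _ ≤ ε * (Fintype.card ι * ∑ i, ‖c i‖ ^ 2) := by gcongr
      _ = ε * Fintype.card ι * ∑ i, ‖c i‖ ^ 2 := by ring
      _ ≤ _ := by gcongr
  linarith

/-- Independent unit vectors whose inner products are controlled by a multiplicative
similarity `μ`, and which become Gaussian-integer vectors after a bounded rescaling adapted to any
one of them, are uniformly well conditioned. -/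
theorem exists_coefficient_bound (ι : Type*) [Fintype ι] :
    ∃ C : ℝ, 0 < C ∧ ∀ (E : Type) [NormedAddCommGroup E] [InnerProductSpace ℂ E]
      (s : ι → E) (μ : ι → ι → ℝ), LinearIndependent ℂ s →
      (∀ i j, μ i j = μ j i) → (∀ i, 1 ≤ μ i i) →
      (∀ i j k, μ i j * μ j k ≤ 4 * μ i k) →
      (∀ i j, ‖(inner ℂ (s i) (s j) : ℂ)‖ ^ 2 ≤ μ i j) →
      (∀ a, ∃ α : ι → ℂ, (∀ i, α i ≠ 0 ∧ ‖α i‖ * μ a i ≤ 4) ∧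
        ∀ i j, (inner ℂ (α i • s i) (α j • s j) : ℂ) ∈ GaussianInt.toComplex.range) →
      (∀ i, ‖s i‖ = 1) →
      ∀ φ ∈ Submodule.span ℂ (Set.range s), ∃ e : ι → ℂ, φ = ∑ i, e i • s i ∧
        ∑ i, ‖e i‖ ≤ C * ‖φ‖ := by
  classical
  obtain ⟨η, l, hη, hl, hanti, hsq, hε, hform⟩ := exists_thresholds ι
  let K : ℕ → ℝ := fun j => 4 / η j * √(Fintype.card ι * (2 / l j))
  have hK : ∀ j, 0 ≤ K j := fun j => by have := (hη j).1; positivity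
  -- The scale `j` depends on the family, so the constant sums `K` over all scales that the
  -- pigeonhole can return.
  refine ⟨1 + ∑ j ∈ Finset.range (Fintype.card (ι × ι) + 1), K j,
    add_pos_of_pos_of_nonneg one_pos (Finset.sum_nonneg fun j _ => hK j), ?_⟩
  intro E _ _ s μ hli hsymm hrefl hmul hinner hint hunit φ hφ
  obtain ⟨j, hj, hstep⟩ := exists_le_card_eq_succ
    (A := fun j => Finset.univ.filter fun p : ι × ι => η j ≤ μ p.1 p.2) (fun j j' h p hp => by
      simp only [Finset.mem_filter, Finset.mem_univ, true_and] at hp ⊢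
      exact (hanti h).trans hp)
  -- No `μ i i'` lies in `[η (j + 1), η j)`.
  have hgap : ∀ i i', η (j + 1) ≤ μ i i' → η j ≤ μ i i' := by
    intro i i' h
    have : (i, i') ∈ Finset.univ.filter fun p : ι × ι => η j ≤ μ p.1 p.2 := by
      rw [hstep]
      simpa using h
    simpa using this
  have hη0 := (hη j).1
  -- Transitivity: `4 η (j + 1) ≤ η j ^ 2 ≤ μ a b * μ b c ≤ 4 μ a c`, and the gap lifts `η (j + 1) ≤
  -- μ a c` to `η j ≤ μ a c`.
  let st : Setoid ι :=
    { r := fun i i' => η j ≤ μ i i'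
      iseqv :=
        { refl := fun i => (hη j).2.trans (hrefl i)
          symm := fun {i i'} h => by rwa [hsymm i' i]
          trans := fun {a b c} h h' => hgap _ _ (by
            have h1 := hmul a b c
            have h2 : η j * η j ≤ μ a b * μ b c :=
              mul_le_mul h h' hη0.le (hη0.le.trans h)
            have h3 := hsq j
            nlinarith) } }
  let rep : ι → ι := fun i => (Quotient.mk st i).out
  have hrep : ∀ i, η j ≤ μ (rep i) i := fun i => Quotient.mk_out (s := st) i
  have hrep' : ∀ i i', rep i ≠ rep i' → μ i i' < η (j + 1) := by
    intro i i' h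
    by_contra! h1
    exact h (congrArg Quotient.out (Quotient.sound (s := st) (hgap _ _ h1)))
  choose α hα hαint using hint
  -- Each class uses the rescaling adapted to its own representative, so inner products within a
  -- class are Gaussian integers.
  let β : ι → ℂ := fun i => α (rep i) i
  have hβ0 : ∀ i, β i ≠ 0 := fun i => (hα _ _).1
  have hβ : ∀ i, ‖β i‖ ≤ 4 / η j := by
    intro i
    rw [le_div_iff₀ hη0]
    exact (mul_le_mul_of_nonneg_left (hrep i) (norm_nonneg _)).trans (hα _ _).2
  let v : ι → E := fun i => β i • s i
  have hvnorm : ∀ i, ‖v i‖ ≤ 4 / η j := by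
    intro i
    simpa [v, norm_smul, hunit] using hβ i
  have hQent : ∀ i i', (Matrix.of (fun i j => if rep i = rep j then inner ℂ (v i) (v j) else 0)
      : Matrix ι ι ℂ) i i' ∈ GaussianInt.toComplex.range ∧
      ‖(Matrix.of (fun i j => if rep i = rep j then inner ℂ (v i) (v j) else 0)
      : Matrix ι ι ℂ) i i'‖ ≤ (4 / η j) ^ 2 := by
    intro i i'
    rw [Matrix.of_apply]
    split_ifs with h
    · constructor
      · have := hαint (rep i) i i'
        simpa only [v, β, ← h] using this
      · rw [sq]
        exact (norm_inner_le_norm _ _).trans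
          (mul_le_mul (hvnorm i) (hvnorm i') (norm_nonneg _) (by positivity))
    · exact ⟨zero_mem _, by rw [norm_zero]; positivity⟩
  -- The form is a sum of squared norms of block sums; if all vanish, so does the total, and
  -- independence forces `c = 0`.
  have hQpos : ∀ c : ι → ℂ, c ≠ 0 → 0 < (star c ⬝ᵥ (Matrix.of
      (fun i j => if rep i = rep j then inner ℂ (v i) (v j) else 0) *ᵥ c)).re := by
    intro c hc
    rw [star_dotProduct_mulVec_blockGram, Complex.re_sum]
    have hsqn : ∀ x : E, (inner ℂ x x : ℂ).re = ‖x‖ ^ 2 := inner_self_eq_norm_sq (𝕜 := ℂ)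
    simp only [hsqn]
    refine lt_of_le_of_ne (Finset.sum_nonneg fun a _ => sq_nonneg _) fun h0 => hc ?_
    rw [eq_comm, Finset.sum_eq_zero_iff_of_nonneg fun a _ => sq_nonneg _] at h0
    have h1 : ∑ i, (c i * β i) • s i = 0 := by
      have : ∑ a, ∑ i, (if rep i = a then c i • v i else 0) = 0 :=
        Finset.sum_eq_zero fun a ha => by simpa using h0 a ha
      rw [Finset.sum_comm] at this
      simpa [v, smul_smul] using this
    funext i
    have := Fintype.linearIndependent_iff.mp hli _ h1 i
    exact (mul_eq_zero.mp this).resolve_right (hβ0 i)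
  have hoff : ∀ i i', rep i ≠ rep i' →
      ‖(inner ℂ (v i) (v i') : ℂ)‖ ≤ (4 / η j) ^ 2 * √(η (j + 1)) := by
    intro i i' h
    have h1 : ‖(inner ℂ (s i) (s i') : ℂ)‖ ≤ √(η (j + 1)) :=
      Real.le_sqrt_of_sq_le ((hinner i i').trans (hrep' i i' h).le)
    simp only [v, inner_smul_left, inner_smul_right, norm_mul, RCLike.norm_conj]
    calc ‖β i'‖ * (‖β i‖ * ‖(inner ℂ (s i) (s i') : ℂ)‖)
        ≤ 4 / η j * (4 / η j * √(η (j + 1))) := by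
          gcongr
          exacts [hβ i', hβ i]
      _ = _ := by ring
  obtain ⟨e, rfl⟩ := (Submodule.mem_span_range_iff_exists_fun ℂ).mp hφ
  refine ⟨e, rfl, ?_⟩
  let c : ι → ℂ := fun i => e i / β i
  have hev : ∑ i, e i • s i = ∑ i, c i • v i :=
    Finset.sum_congr rfl fun i _ => by simp [c, v, smul_smul, hβ0 i]
  have hlower := sum_norm_sq_le_of_blockGram v rep c (hε j) hoff (by positivity)
    (hform j _ hQent hQpos c)
  rw [← hev] at hlower
  have hlj := hl j
  have h1 : ∑ i, ‖c i‖ ≤ √(Fintype.card ι * (2 / l j)) * ‖∑ i, e i • s i‖ := by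
    rw [← Real.sqrt_sq (norm_nonneg (∑ i, e i • s i)), ← Real.sqrt_mul (by positivity)]
    refine Real.le_sqrt_of_sq_le (sq_sum_le_card_mul_sum_sq.trans ?_)
    rw [Finset.card_univ, mul_assoc]
    gcongr
    rw [div_mul_eq_mul_div, le_div_iff₀ hlj]
    linarith
  calc ∑ i, ‖e i‖ = ∑ i, ‖β i‖ * ‖c i‖ :=
        Finset.sum_congr rfl fun i _ => by rw [← norm_mul, mul_div_cancel₀ _ (hβ0 i)]
    _ ≤ ∑ i, 4 / η j * ‖c i‖ := by gcongr with i; exact hβ i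
    _ ≤ K j * ‖∑ i, e i • s i‖ := by
        rw [← Finset.mul_sum, mul_assoc]
        gcongr
    _ ≤ _ := by
        gcongr
        have := Finset.single_le_sum (f := K) (fun j _ => hK j)
          (Finset.mem_range.mpr (Nat.lt_succ_of_le hj))
        linarith

/-! ### Stabilizer states: coefficient bound and fidelity -/

theorem exists_stabilizes_of_mem_stabilizerStates {n : ℕ} {s : QubitSpace n}
    (hs : s ∈ stabilizerStates n) :
    ∃ S : Subgroup (Matrix.unitaryGroup (Bits n) ℂ), Stabilizes S s.ofLp := by
  obtain ⟨hn, S, hle, -, hcard, hfix⟩ := hs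
  refine ⟨S, hle, hcard, hfix, ?_⟩
  rw [dotProduct_comm, ← EuclideanSpace.inner_eq_star_dotProduct, inner_self_eq_norm_sq_to_K, hn]
  simp

/-- A state in the span of `r` independent stabilizer states has bounded coefficients. -/
theorem exists_stabilizer_coefficient_bound (r : ℕ) :
    ∃ C : ℝ, 0 < C ∧ ∀ (n : ℕ) (s : Fin r → QubitSpace n), (∀ i, s i ∈ stabilizerStates n) →
      LinearIndependent ℂ s → ∀ φ ∈ Submodule.span ℂ (Set.range s),
      ∃ e : Fin r → ℂ, φ = ∑ i, e i • s i ∧ ∑ i, ‖e i‖ ≤ C * ‖φ‖ := by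
  obtain ⟨C, hC, h⟩ := exists_coefficient_bound (Fin r)
  refine ⟨C, hC, fun n s hs hli => ?_⟩
  choose S hS using fun i => exists_stabilizes_of_mem_stabilizerStates (hs i)
  have hpow : (0 : ℝ) < 2 ^ n := by positivity
  refine h (QubitSpace n) s (fun i j => (Nat.card (pauliEigenGroup (s i).ofLp ⊓
    pauliEigenGroup (s j).ofLp : Subgroup _) : ℝ) / 2 ^ n) hli ?_ ?_ ?_ ?_ ?_ fun i => (hs i).1
  · intro i j
    rw [inf_comm]
  · intro i
    rw [inf_idem, one_le_div hpow]
    exact_mod_cast (hS i).le_card_pauliEigenGroup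
  · intro i j k
    rw [div_mul_div_comm, ← mul_div_assoc, div_le_div_iff₀ (by positivity) hpow]
    have h1 : ((Nat.card (pauliEigenGroup (s i).ofLp ⊓ pauliEigenGroup (s j).ofLp : Subgroup _) *
        Nat.card (pauliEigenGroup (s j).ofLp ⊓ pauliEigenGroup (s k).ofLp : Subgroup _) : ℕ) : ℝ) ≤
        ((Nat.card (pauliEigenGroup (s i).ofLp ⊓ pauliEigenGroup (s k).ofLp : Subgroup _) *
        (4 * 2 ^ n) : ℕ) : ℝ) :=
      Nat.cast_le.mpr ((hS j).card_inf_mul_card_inf_le (s i).ofLp (s k).ofLp)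
    push_cast at h1
    calc _ ≤ _ := mul_le_mul_of_nonneg_right h1 hpow.le
      _ = _ := by ring
  · intro i j
    rw [le_div_iff₀ hpow, EuclideanSpace.inner_eq_star_dotProduct, dotProduct_comm]
    exact (hS i).norm_dotProduct_sq_le (hS j)
  · intro a
    choose α O hα0 hα hO hαO hcard using fun i => (hS a).exists_smul_eq_sum (hS i)
    refine ⟨α, fun i => ⟨hα0 i, ?_⟩, fun i j => ?_⟩
    · rw [← mul_div_assoc, div_le_iff₀ hpow]
      refine (mul_le_mul_of_nonneg_right (hαO i) (Nat.cast_nonneg _)).trans ?_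
      exact_mod_cast hcard i
    · rw [EuclideanSpace.inner_eq_star_dotProduct, dotProduct_comm, WithLp.ofLp_smul,
        WithLp.ofLp_smul, hα, hα]
      exact (hS a).dotProduct_sum_mem (hO i) (hO j)

theorem exists_mem_span_of_stabilizerRank_le {n k : ℕ} {φ : QubitSpace n}
    (h : stabilizerRank φ ≤ (k : ℕ∞)) :
    ∃ m ≤ k, ∃ s : Fin m → QubitSpace n,
      (∀ i, s i ∈ stabilizerStates n) ∧ φ ∈ Submodule.span ℂ (Set.range s) := by
  have h1 : stabilizerRank φ < ((k + 1 : ℕ) : ℕ∞) :=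
    h.trans_lt (by exact_mod_cast Nat.lt_succ_self k)
  obtain ⟨_, ⟨m, rfl, s, hs⟩, hm⟩ := sInf_lt_iff.mp h1
  exact ⟨m, Nat.lt_succ_iff.mp (by exact_mod_cast hm), s, hs⟩

theorem exists_linearIndependent_fin_span_eq {K V : Type*} [DivisionRing K] [AddCommGroup V]
    [Module K V] {m : ℕ} (s : Fin m → V) :
    ∃ r ≤ m, ∃ t : Fin r → V, Set.range t ⊆ Set.range s ∧ LinearIndependent K t ∧
      Submodule.span K (Set.range t) = Submodule.span K (Set.range s) := by
  obtain ⟨b, hb, hspan, hli⟩ := exists_linearIndependent K (Set.range s)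
  have hfin : b.Finite := (Set.finite_range s).subset hb
  have := hfin.to_subtype
  have hcard : Nat.card b ≤ m := by
    refine (Nat.card_mono (Set.finite_range s) hb).trans ?_
    simpa using Finite.card_range_le s
  let e := Finite.equivFin b
  have hr : Set.range (Subtype.val ∘ e.symm) = b := by
    rw [e.symm.surjective.range_comp, Subtype.range_coe]
  exact ⟨Nat.card b, hcard, Subtype.val ∘ e.symm, hr.subset.trans hb,
    hli.comp _ e.symm.injective, by rw [hr, hspan]⟩

theorem theorem2 (k : ℕ) (hk : 0 < k) :
    ∃ δ : ℝ, 0 < δ ∧ ∀ (n : ℕ) (φ : QubitSpace n), ‖φ‖ = 1 →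
      stabilizerRank φ ≤ (k : ℕ∞) → δ ≤ stabilizerFidelity φ := by
  choose C hC hbound using exists_stabilizer_coefficient_bound
  -- The number `r ≤ k` of independent states is not known in advance, so `D` dominates every `C r`.
  set D : ℝ := ∑ r ∈ Finset.range (k + 1), C r with hD
  have hDpos : 0 < D := Finset.sum_pos (fun r _ => hC r) (by simp)
  refine ⟨(1 / D) ^ 2, by positivity, fun n φ hφ hrank => ?_⟩
  obtain ⟨m, hm, s, hs, hspan⟩ := exists_mem_span_of_stabilizerRank_le hrank
  obtain ⟨r, hr, t, hts, hli, hspan'⟩ := exists_linearIndependent_fin_span_eq (K := ℂ) s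
  have ht : ∀ i, t i ∈ stabilizerStates n := fun i => by
    obtain ⟨j, hj⟩ := hts ⟨i, rfl⟩
    exact hj ▸ hs j
  obtain ⟨e, he, hsum⟩ := hbound r n t ht hli φ (hspan'.symm ▸ hspan)
  have hCD : C r ≤ D := Finset.single_le_sum (f := C) (fun r _ => (hC r).le)
    (Finset.mem_range.mpr (by omega))
  have hfid : ∀ i, ‖(inner ℂ φ (t i) : ℂ)‖ ≤ √(stabilizerFidelity φ) := fun i => by
    rw [norm_inner_symm]
    exact Real.le_sqrt_of_sq_le ((isGreatest_stabilizerFidelity φ).2 ⟨t i, ht i, rfl⟩)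
  have h1 : (1 : ℝ) ≤ D * √(stabilizerFidelity φ) := by
    calc (1 : ℝ) = ‖(inner ℂ φ φ : ℂ)‖ := by simp [inner_self_eq_norm_sq_to_K, hφ]
      _ = ‖∑ i, e i * inner ℂ φ (t i)‖ := by
        conv_lhs => rw [he, inner_sum, ← he]
        simp only [inner_smul_right]
      _ ≤ ∑ i, ‖e i‖ * √(stabilizerFidelity φ) :=
        norm_sum_le_of_le _ fun i _ => by
          rw [norm_mul]
          exact mul_le_mul_of_nonneg_left (hfid i) (norm_nonneg _)
      _ ≤ D * √(stabilizerFidelity φ) := by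
        rw [← Finset.sum_mul]
        rw [hφ, mul_one] at hsum
        exact mul_le_mul_of_nonneg_right (hsum.trans hCD) (Real.sqrt_nonneg _)
  have h2 : 0 < √(stabilizerFidelity φ) := by
    by_contra h
    nlinarith [mul_nonpos_of_nonneg_of_nonpos hDpos.le (not_lt.mp h)]
  rw [← Real.sq_sqrt (Real.sqrt_pos.mp h2).le]
  gcongr
  rwa [div_le_iff₀' hDpos]
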